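/- Let $\mathbb{F}_4=\{0,1,\omega,\omega^2\}$ be the field with four elements, where $\omega^2+\omega+1=0$. For $x,y\in\mathbb{F}_4^n$ let $(x,y)_h=\sum_{i=1}^n x_i y_i^2$ be the Hermitian inner product, and for a quaternary code, i.e. a linear subspace $C\subseteq\mathbb{F}_4^n$, let $C^{\perp h}=\{x\in\mathbb{F}_4^n : (x,y)_h=0 \text{ for all } y\in C\}$. The code $C$ is Hermitian LCD if $C\cap C^{\perp h}=\{0\}$. An $[n,k,d]$ code is a $k$-dimensional subspace of $\mathbb{F}_4^n$ whose minimum weight (the least number of nonzero coordinates of a nonzero codeword) is exactly $d$. For a $k\times(n-k)$ matrix $A$ over $\mathbb{F}_4$ with rows $r_1,\dots,r_k$ and $x,y\in\mathbb{F}_4^{n-k}$, let $A(x,y)$ be the $k\times(n-k)$ matrix with rows $r_i+(r_i,y)_h\,x-(r_i,x)_h\,y$. **Proposition 5.3.** A quaternary Hermitian LCD $[n,k,d]$ code exists for each $$(n,k,d)\in\{(27,6,15),(27,8,13),(27,9,12),(27,11,10),(28,11,11),(29,11,11),(30,7,16),(30,12,11)\}.$$ Moreover, for each of these $(n,k,d)$,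 the vectors $x,y\in\mathbb{F}_4^{n-k}$ listed below satisfy $(x,x)_h=(y,y)_h=(x,y)_h=0$, and there is a $k\times(n-k)$ matrix $A$ over $\mathbb{F}_4$ such that the code with generator matrix $(I_k\;\,A)$ is a Hermitian LCD $[n,k,d-1]$ code and the code with generator matrix $(I_k\;\,A(x,y))$ is a Hermitian LCD $[n,k,d]$ code. - $(n,k,d)=(27,6,15)$: $x=(\omega,1,\omega^2,1,1,\omega,\omega,1,\omega,0,0,0,\omega^2,0,\omega,0,\omega,\omega,\omega,\omega^2,\omega)$, $y=(\omega,\omega,\omega,\omega,\omega,\omega^2,0,\omega^2,1,\omega^2,0,0,0,0,\omega,1,\omega^2,\omega,\omega^2,\omega,\omega)$. - $(n,k,d)=(27,8,13)$: $x=(\omega^2,0,\omega,1,1,\omega^2,0,\omega^2,\omega^2,0,\omega,1,0,\omega^2,\omega^2,\omega,\omega^2,1,0)$, $y=(\omega^2,\omega^2,1,\omega^2,\omega^2,\omega,\omega^2,1,1,\omega,1,0,0,1,\omega,0,0,\omega^2,0)$. - $(n,k,d)=(27,9,12)$: $x=(1,1,1,\omega,0,1,0,\omega,0,\omega,0,\omega^2,\omega,1,\omega,1,\omega^2,\omega)$,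 $y=(0,0,\omega^2,1,\omega,\omega,\omega,0,1,0,\omega,1,1,\omega^2,1,\omega^2,0,0)$. - $(n,k,d)=(27,11,10)$: $x=(\omega^2,1,1,\omega^2,\omega,0,\omega^2,\omega,\omega^2,0,\omega,\omega^2,1,1,\omega,\omega^2)$, $y=(0,0,0,1,1,\omega^2,1,\omega,1,0,1,\omega^2,1,0,1,0)$. - $(n,k,d)=(28,11,11)$: $x=(\omega,\omega^2,0,\omega,\omega,0,\omega,1,\omega^2,0,0,0,1,1,\omega^2,\omega,1)$, $y=(0,\omega^2,\omega^2,1,0,0,1,\omega,\omega^2,1,\omega,1,\omega,0,0,\omega^2,\omega)$. - $(n,k,d)=(29,11,11)$: $x=(0,\omega,0,1,0,\omega,\omega,\omega^2,1,\omega,\omega^2,1,0,\omega^2,0,\omega^2,\omega^2,0)$, $y=(\omega^2,\omega^2,\omega,\omega,\omega^2,\omega,0,1,\omega^2,0,\omega^2,0,0,1,1,\omega,0,0)$. - $(n,k,d)=(30,7,16)$: $x=(\omega^2,\omega,1,1,0,\omega^2,\omega^2,\omega,1,1,\omega^2,0,0,\omega^2,1,\omega^2,\omega^2,\omega^2,0,\omega,\omega,0,\omega^2)$,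 $y=(1,\omega,1,0,0,1,\omega,1,1,\omega,1,0,1,0,\omega,0,\omega^2,\omega^2,1,\omega^2,\omega,0,0)$. - $(n,k,d)=(30,12,11)$: $x=(1,0,0,1,\omega,0,\omega,0,\omega^2,\omega^2,\omega^2,\omega^2,1,\omega,0,0,\omega,1)$, $y=(1,\omega^2,0,0,\omega^2,\omega,0,\omega^2,0,\omega^2,\omega^2,0,\omega,0,1,\omega^2,\omega^2,\omega^2)$. -/

import Mathlib

namespace HermitianLCD

/-- The Hermitian inner product `(x, y)_h = ∑ i, x i * conj (y i)`, where `conj a = a ^ q`.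
It is meant for vectors over the field with `q ^ 2` elements. -/
def hermInner {F ι : Type*} [Field F] [Fintype ι] (q : ℕ) (x y : ι → F) : F :=
  ∑ i, x i * y i ^ q

/-- The Hermitian dual code `{x | (x, y)_h = 0 for all y ∈ C}`. -/
def hermDual {F ι : Type*} [Field F] [Fintype ι] (q : ℕ) (C : Submodule F (ι → F)) :
    Submodule F (ι → F) where
  carrier := {x | ∀ y ∈ C, hermInner q x y = 0}
  add_mem' := by
    intro a b ha hb y hy
    have h1 := ha y hy
    have h2 := hb y hy
    simp only [hermInner] at h1 h2 ⊢
    simp only [Pi.add_apply, add_mul, Finset.sum_add_distrib, h1, h2, add_zero]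
  zero_mem' := by
    intro y _
    simp [hermInner]
  smul_mem' := by
    intro c a ha y hy
    have h1 := ha y hy
    simp only [hermInner] at h1 ⊢
    simp only [Pi.smul_apply, smul_eq_mul, mul_assoc, ← Finset.mul_sum, h1, mul_zero]

/-- `C` is a Hermitian LCD code: it meets its Hermitian dual only in the zero vector. -/
def IsHermitianLCD {F ι : Type*} [Field F] [Fintype ι] (q : ℕ) (C : Submodule F (ι → F)) : Prop :=
  C ⊓ hermDual q C = ⊥

/-- `d` is the minimum weight of `C`: the least Hamming weight of a nonzero codeword
(and there is a nonzero codeword). -/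
def HasMinWeight {F ι : Type*} [Field F] [DecidableEq F] [Fintype ι]
    (C : Submodule F (ι → F)) (d : ℕ) : Prop :=
  IsLeast {w : ℕ | ∃ c ∈ C, c ≠ 0 ∧ hammingNorm c = w} d

/-- `C` is an `[n, k, d]` code that is Hermitian LCD; the length `n` is part of the type of `C`. -/
def IsHermitianLCDCode {F : Type*} [Field F] [DecidableEq F] (q : ℕ) {n : ℕ} (k d : ℕ)
    (C : Submodule F (Fin n → F)) : Prop :=
  Module.finrank F C = k ∧ HasMinWeight C d ∧ IsHermitianLCD q C

/-- The `k × (k + m)` matrix `(I_k  A)`. -/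
def systematicMatrix {F : Type*} [Field F] {k m : ℕ} (A : Matrix (Fin k) (Fin m) F) :
    Matrix (Fin k) (Fin (k + m)) F :=
  Matrix.of fun i => Fin.append ((1 : Matrix (Fin k) (Fin k) F) i) (A i)

/-- The code of length `k + m` with generator matrix `(I_k  A)`, that is, its row space. -/
def systematicCode {F : Type*} [Field F] {k m : ℕ} (A : Matrix (Fin k) (Fin m) F) :
    Submodule F (Fin (k + m) → F) :=
  Submodule.span F (Set.range fun i => systematicMatrix A i)

/-- The matrix `A(x, y)`, with rows `r_i + (r_i, y)_h x - (r_i, x)_h y`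
where `r_i` are the rows of `A`. -/
def modifiedMatrix {F : Type*} [Field F] {k m : ℕ} (q : ℕ) (A : Matrix (Fin k) (Fin m) F)
    (x y : Fin m → F) : Matrix (Fin k) (Fin m) F :=
  Matrix.of fun i => A i + hermInner q (A i) y • x - hermInner q (A i) x • y

/-- The vectors `x, y` satisfy `(x, x)_h = (y, y)_h = (x, y)_h = 0`, and there is a Hermitian LCD
`[k + m, k, d₀]` code with generator matrix `(I_k  A)` for which the code with generator matrix
`(I_k  A(x, y))` is a Hermitian LCD `[k + m, k, d]` code. -/
def ConstructionYields {F : Type*} [Field F] [DecidableEq F] (q k m d₀ d : ℕ)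
    (x y : Fin m → F) : Prop :=
  hermInner q x x = 0 ∧ hermInner q y y = 0 ∧ hermInner q x y = 0 ∧
    ∃ A : Matrix (Fin k) (Fin m) F,
      IsHermitianLCDCode q k d₀ (systematicCode A) ∧
      IsHermitianLCDCode q k d (systematicCode (modifiedMatrix q A x y))

end HermitianLCD

/-!
The existence claim follows from the eight constructions, so the task is to exhibit a matrix `A` for
each of the given pairs `x, y` and to verify the two codes.

Since `x` and `y` are isotropic and orthogonal, `r ↦ r + (r, y)_h x - (r, x)_h y` is a unitary map
(`systematicGram_modifiedMatrix`), so the codes generated by `(I_k  A)` and `(I_k  A(x, y))` have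
the same Hermitian Gram matrix `1 + A A†`. Both are LCD as soon as this matrix has an inverse
(`isHermitianLCD_systematicCode`), and the inverse is given explicitly. The map being an involution,
`A` arises from a matrix `B = A(x, y)` whose code has minimum weight `d`; the matrices `B` used here
come from codes with a nontrivial monomial automorphism, with coordinates ordered and scaled so that
the code of `A` has minimum weight exactly `d - 1`.

The upper bounds for the minimum weights are shown by explicit codewords. For the lower bounds all
codewords with leading message entry `1` are examined, up to `4 ^ 11` at a time: a natural number
serves as a truth table with one bit per codeword. For each coordinate the truth table of "the
codeword does not vanish here" is built by repeated doubling (`GF4.testBit_table`), and these tables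
are summed in a binary counter whose digits are again truth tables (`counterValue_counterAdd_le`), so
that a few thousand bitwise operations on large numbers determine all weights
(`GF4.le_hammingNorm_of_minWeightCheck`).

All computations take place in the concrete field `GF4`; `ConstructionYields.map` carries the result
to an arbitrary field with four elements.
-/

namespace HermitianLCD

/-! ### A concrete field with four elements -/

/-- The field with four elements as an enumerated type, so that its operations compute in the
kernel; `w` and `w2` are the two primitive cube roots of unity. -/
inductive GF4 : Type
  | zero | one | w | w2
  deriving DecidableEq

namespace GF4

/-- The coefficient of `1` in the basis `1, w` over the field with two elements. -/
def lo : GF4 → Bool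
  | zero => false | one => true | w => false | w2 => true

/-- The coefficient of `w` in the basis `1, w` over the field with two elements. -/
def hi : GF4 → Bool
  | zero => false | one => false | w => true | w2 => true

/-- The element `a + b w`. -/
def ofBits : Bool → Bool → GF4
  | false, false => zero | true, false => one | false, true => w | true, true => w2

instance : Fintype GF4 := ⟨{zero, one, w, w2}, by intro a; cases a <;> decide⟩
instance : Zero GF4 := ⟨zero⟩
instance : One GF4 := ⟨one⟩
instance : Add GF4 := ⟨fun a b => ofBits (lo a ^^ lo b) (hi a ^^ hi b)⟩
instance : Neg GF4 := ⟨fun a => a⟩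
instance : Mul GF4 := ⟨fun a b => match a, b with
  | zero, _ => zero | one, b => b
  | w, zero => zero | w, one => w | w, w => w2 | w, w2 => one
  | w2, zero => zero | w2, one => w2 | w2, w => one | w2, w2 => w⟩
instance : Inv GF4 := ⟨fun a => match a with
  | zero => zero | one => one | w => w2 | w2 => w⟩

instance : Field GF4 where
  add_assoc := by decide
  zero_add := by decide
  add_zero := by decide
  add_comm := by decide
  neg_add_cancel := by decide
  mul_assoc := by decide
  one_mul := by decide
  mul_one := by decide
  zero_mul := by decide
  mul_zero := by decide
  left_distrib := by decide
  right_distrib := by decide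
  mul_comm := by decide
  mul_inv_cancel := by decide
  inv_zero := by decide
  exists_pair_ne := ⟨zero, one, by decide⟩
  nsmul := nsmulRec
  zsmul := zsmulRec
  nnqsmul := _
  nnqsmul_def _ _ := rfl
  qsmul := _
  qsmul_def _ _ := rfl

theorem lo_add : ∀ a b : GF4, lo (a + b) = (lo a ^^ lo b) := by decide

theorem hi_add : ∀ a b : GF4, hi (a + b) = (hi a ^^ hi b) := by decide

theorem add_self : ∀ a : GF4, a + a = 0 := by decide

theorem sub_eq_add : ∀ a b : GF4, a - b = a + b := by decide

theorem sq_add : ∀ a b : GF4, (a + b) ^ 2 = a ^ 2 + b ^ 2 := by decide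

theorem sq_sq : ∀ a : GF4, (a ^ 2) ^ 2 = a := by decide

/-- Any field with four elements in which `ω ^ 2 + ω + 1 = 0` is a copy of `GF4`, with `w`
corresponding to `ω`. -/
theorem exists_ringEquiv {F : Type*} [Field F] [Fintype F] (hF : Fintype.card F = 4)
    (ω : F) (hω : ω ^ 2 + ω + 1 = 0) :
    ∃ φ : GF4 ≃+* F, φ zero = 0 ∧ φ one = 1 ∧ φ w = ω ∧ φ w2 = ω ^ 2 := by
  -- The characteristic is two because `card F = 2 * 2` vanishes in `F`.
  have h2 : (2 : F) = 0 := by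
    have h4 : ((Fintype.card F : ℕ) : F) = 0 := Nat.cast_card_eq_zero F
    rw [hF] at h4
    have h22 : (2 : F) * 2 = 0 := by rw [← h4]; norm_num
    exact mul_self_eq_zero.mp h22
  let f : GF4 → F := fun a => match a with
    | zero => 0 | one => 1 | w => ω | w2 => ω ^ 2
  have hadd : ∀ a b, f (a + b) = f a + f b := by
    intro a b
    obtain ⟨c, hc⟩ : ∃ c, c = a + b := ⟨_, rfl⟩
    rw [← hc]
    cases a <;> cases b <;> cases c <;> dsimp only [f] <;> first
      | exact absurd hc (by decide)
      | ring1
      | linear_combination -h2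
      | linear_combination -ω * h2
      | linear_combination -ω ^ 2 * h2
      | linear_combination hω - (ω + 1) * h2
      | linear_combination hω - (ω ^ 2 + ω) * h2
      | linear_combination hω - (ω ^ 2 + 1) * h2
  have hmul : ∀ a b, f (a * b) = f a * f b := by
    intro a b
    obtain ⟨c, hc⟩ : ∃ c, c = a * b := ⟨_, rfl⟩
    rw [← hc]
    cases a <;> cases b <;> cases c <;> dsimp only [f] <;> first
      | exact absurd hc (by decide)
      | ring1
      | linear_combination (1 - ω) * hω
      | linear_combination (ω - ω ^ 2) * hω
  let g : GF4 →+* F :=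
    { toFun := f, map_one' := rfl, map_mul' := hmul, map_zero' := rfl, map_add' := hadd }
  have hg : Function.Bijective g := by
    rw [Fintype.bijective_iff_injective_and_card]
    exact ⟨g.injective, by rw [hF]; rfl⟩
  exact ⟨RingEquiv.ofBijective g hg, rfl, rfl, rfl, rfl⟩

end GF4

/-! ### Systematic codes and change of field -/

section Transport

variable {F K : Type*} [Field F] [Field K] {k m : ℕ}

theorem mem_systematicCode {A : Matrix (Fin k) (Fin m) F} {c : Fin (k + m) → F} :
    c ∈ systematicCode A ↔ ∃ u : Fin k → F, Matrix.vecMul u (systematicMatrix A) = c := by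
  rw [systematicCode, Submodule.mem_span_range_iff_exists_fun]
  simp only [Matrix.vecMul_eq_sum]

theorem vecMul_systematicMatrix_castAdd (A : Matrix (Fin k) (Fin m) F) (u : Fin k → F)
    (i : Fin k) : Matrix.vecMul u (systematicMatrix A) (Fin.castAdd m i) = u i := by
  simp [Matrix.vecMul, dotProduct, systematicMatrix, Matrix.one_apply]

theorem vecMul_systematicMatrix_eq_zero_iff (A : Matrix (Fin k) (Fin m) F) (u : Fin k → F) :
    Matrix.vecMul u (systematicMatrix A) = 0 ↔ u = 0 := by
  refine ⟨fun h => funext fun i => ?_, fun h => by rw [h, Matrix.zero_vecMul]⟩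
  rw [← vecMul_systematicMatrix_castAdd A u i, h]
  rfl

theorem finrank_systematicCode (A : Matrix (Fin k) (Fin m) F) :
    Module.finrank F (systematicCode A) = k := by
  have hli : LinearIndependent F fun i => systematicMatrix A i := by
    rw [Fintype.linearIndependent_iff]
    intro u hu
    rw [← Matrix.vecMul_eq_sum, vecMul_systematicMatrix_eq_zero_iff] at hu
    exact congrFun hu
  rw [systematicCode, finrank_span_eq_card hli, Fintype.card_fin]

theorem systematicMatrix_map (φ : K ≃+* F) (A : Matrix (Fin k) (Fin m) K) :
    systematicMatrix (A.map φ) = (systematicMatrix A).map φ := by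
  ext i j
  refine Fin.addCases (fun j => ?_) (fun j => ?_) j
  · by_cases h : i = j <;> simp [systematicMatrix, h]
  · simp [systematicMatrix]

theorem vecMul_map (φ : K ≃+* F) {n : ℕ} (G : Matrix (Fin k) (Fin n) K) (u : Fin k → K) :
    Matrix.vecMul (φ ∘ u) (G.map φ) = φ ∘ Matrix.vecMul u G := by
  ext j
  simp [Matrix.vecMul, dotProduct]

theorem hermInner_comp (φ : K ≃+* F) (q : ℕ) {n : ℕ} (x y : Fin n → K) :
    hermInner q (φ ∘ x) (φ ∘ y) = φ (hermInner q x y) := by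
  simp [hermInner]

theorem modifiedMatrix_map (φ : K ≃+* F) (q : ℕ) (A : Matrix (Fin k) (Fin m) K)
    (x y : Fin m → K) :
    modifiedMatrix q (A.map φ) (φ ∘ x) (φ ∘ y) = (modifiedMatrix q A x y).map φ := by
  ext i j
  have h (z : Fin m → K) : hermInner q (A.map φ i) (φ ∘ z) = φ (hermInner q (A i) z) :=
    hermInner_comp φ q (A i) z
  simp [modifiedMatrix, h]

theorem mem_systematicCode_map (φ : K ≃+* F) (A : Matrix (Fin k) (Fin m) K)
    {c : Fin (k + m) → F} :
    c ∈ systematicCode (A.map φ) ↔ ∃ c' ∈ systematicCode A, φ ∘ c' = c := by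
  simp only [mem_systematicCode, systematicMatrix_map]
  constructor
  · rintro ⟨u, rfl⟩
    refine ⟨_, ⟨φ.symm ∘ u, rfl⟩, ?_⟩
    rw [← vecMul_map]
    congr 1
    ext i
    simp
  · rintro ⟨_, ⟨u, rfl⟩, rfl⟩
    exact ⟨φ ∘ u, vecMul_map φ _ u⟩

theorem comp_eq_zero_iff (φ : K ≃+* F) {n : ℕ} (c : Fin n → K) : φ ∘ c = 0 ↔ c = 0 := by
  simp [funext_iff]

theorem IsHermitianLCDCode.map [DecidableEq F] [DecidableEq K] (φ : K ≃+* F) {q d : ℕ}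
    {A : Matrix (Fin k) (Fin m) K} (h : IsHermitianLCDCode q k d (systematicCode A)) :
    IsHermitianLCDCode q k d (systematicCode (A.map φ)) := by
  obtain ⟨-, hd, hlcd⟩ := h
  refine ⟨finrank_systematicCode _, ?_, ?_⟩
  · have hw (c : Fin (k + m) → K) : hammingNorm (φ ∘ c) = hammingNorm c :=
      hammingNorm_comp (fun _ => φ) (fun _ => φ.injective) (fun _ => map_zero φ)
    rw [HasMinWeight] at hd ⊢
    convert hd using 1
    ext t
    simp only [Set.mem_ofPred_eq, mem_systematicCode_map]
    constructor
    · rintro ⟨_, ⟨c, hc, rfl⟩, h0, ht⟩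
      exact ⟨c, hc, fun h => h0 ((comp_eq_zero_iff φ c).2 h), by rw [← ht, hw]⟩
    · rintro ⟨c, hc, h0, ht⟩
      exact ⟨φ ∘ c, ⟨c, hc, rfl⟩, fun h => h0 ((comp_eq_zero_iff φ c).1 h), by rw [← ht, hw]⟩
  · rw [IsHermitianLCD, eq_bot_iff]
    rintro c ⟨hc, hdual⟩
    obtain ⟨c, hc', rfl⟩ := (mem_systematicCode_map φ A).1 hc
    have hmem : c ∈ systematicCode A ⊓ hermDual q (systematicCode A) := by
      refine Submodule.mem_inf.2 ⟨hc', fun y hy => ?_⟩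
      have := hdual (φ ∘ y) ((mem_systematicCode_map φ A).2 ⟨y, hy, rfl⟩)
      rwa [hermInner_comp, map_eq_zero_iff φ φ.injective] at this
    rw [hlcd, Submodule.mem_bot] at hmem
    rw [Submodule.mem_bot, comp_eq_zero_iff, hmem]

theorem ConstructionYields.map [DecidableEq F] [DecidableEq K] (φ : K ≃+* F) {q d₀ d : ℕ}
    {x y : Fin m → K} (h : ConstructionYields q k m d₀ d x y) :
    ConstructionYields q k m d₀ d (φ ∘ x) (φ ∘ y) := by
  obtain ⟨hx, hy, hxy, A, h₀, h₁⟩ := h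
  refine ⟨?_, ?_, ?_, A.map φ, IsHermitianLCDCode.map φ h₀, ?_⟩
  · rw [hermInner_comp, hx, map_zero]
  · rw [hermInner_comp, hy, map_zero]
  · rw [hermInner_comp, hxy, map_zero]
  · rw [modifiedMatrix_map]
    exact IsHermitianLCDCode.map φ h₁

theorem comp_vecCons {α β : Type*} {n : ℕ} (f : α → β) (a : α) (v : Fin n → α) :
    f ∘ Matrix.vecCons a v = Matrix.vecCons (f a) (f ∘ v) := by
  funext i
  refine Fin.cases rfl (fun i => rfl) i

theorem comp_vecEmpty {α β : Type*} (f : α → β) : f ∘ (![] : Fin 0 → α) = ![] :=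
  Subsingleton.elim _ _

end Transport

/-! ### Bit-sliced weights of all codewords at once -/

/-- Extend a truth table `t` of length `M` by one Boolean variable, whose value is the new leading
index bit and which enters the tabulated function additively, with coefficient `c`. -/
def doubleTable (M t : ℕ) (c : Bool) : ℕ :=
  t ||| ((bif c then t ^^^ (2 ^ M - 1) else t) <<< M)

theorem doubleTable_lt {M t : ℕ} (ht : t < 2 ^ M) (c : Bool) :
    doubleTable M t c < 2 ^ (2 * M) := by
  have hM : 2 ^ M - 1 < 2 ^ M := Nat.sub_lt (by positivity) one_pos
  have h2 : (bif c then t ^^^ (2 ^ M - 1) else t) < 2 ^ M := by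
    cases c
    · exact ht
    · exact Nat.xor_lt_two_pow ht hM
  refine Nat.or_lt_two_pow (ht.trans_le (Nat.pow_le_pow_right two_pos (by omega))) ?_
  rw [Nat.shiftLeft_eq, two_mul, pow_add]
  exact Nat.mul_lt_mul_of_pos_right h2 (by positivity)

theorem testBit_doubleTable {M t i : ℕ} (ht : t < 2 ^ M) (hi : i < M) (b c : Bool) :
    (doubleTable M t c).testBit (b.toNat * M + i) = (t.testBit i ^^ (b && c)) := by
  have h (n : ℕ) : t.testBit (M + n) = false :=
    Nat.testBit_lt_two_pow (ht.trans_le (Nat.pow_le_pow_right two_pos (by omega)))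
  cases b <;> cases c <;>
    simp [doubleTable, Nat.testBit_or, Nat.testBit_shiftLeft, Nat.testBit_two_pow_sub_one, h, hi,
      Nat.not_le.2 hi]

namespace GF4

/-- The scalar product of two lists of field elements. -/
def dot : List GF4 → List GF4 → GF4
  | u :: us, c :: cs => u * c + dot us cs
  | _, _ => 0

/-- The truth table of `us ↦ f (a + dot us cs)`, where the bits of the list `us` form the index. -/
def table (f : GF4 → Bool) (a : GF4) : List GF4 → ℕ
  | [] => (f a).toNat
  | c :: cs =>
    doubleTable (2 * 4 ^ cs.length) (doubleTable (4 ^ cs.length) (table f a cs) (f c)) (f (w * c))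

/-- The position of a list of field elements in a truth table. -/
def index : List GF4 → ℕ
  | [] => 0
  | u :: us => (hi u).toNat * (2 * 4 ^ us.length) + ((lo u).toNat * 4 ^ us.length + index us)

theorem index_lt (us : List GF4) : index us < 4 ^ us.length := by
  induction us with
  | nil => simp [index]
  | cons u us ih => cases u <;> simp [index, lo, hi, pow_succ] <;> omega

theorem table_lt (f : GF4 → Bool) (a : GF4) (cs : List GF4) :
    table f a cs < 2 ^ 4 ^ cs.length := by
  induction cs with
  | nil => cases h : f a <;> simp [table, h]
  | cons c cs ih =>
    have := doubleTable_lt (doubleTable_lt ih (f c)) (f (w * c))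
    rwa [show 2 * (2 * 4 ^ cs.length) = 4 ^ (c :: cs).length by
      rw [List.length_cons, pow_succ]; ring] at this

theorem testBit_table {f : GF4 → Bool} (hf : ∀ a b, f (a + b) = (f a ^^ f b)) (a : GF4)
    {us cs : List GF4} (h : us.length = cs.length) :
    (table f a cs).testBit (index us) = f (a + dot us cs) := by
  induction cs generalizing us with
  | nil =>
    obtain rfl := List.length_eq_zero_iff.1 h
    cases h : f a <;> simp [table, index, dot, h]
  | cons c cs ih =>
    obtain ⟨u, us, rfl⟩ := List.exists_cons_of_length_eq_add_one h
    have hl : us.length = cs.length := by simpa using h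
    have hlt := index_lt us
    have h2 : (lo u).toNat * 4 ^ cs.length + index us < 2 * 4 ^ cs.length := by
      have := Bool.toNat_le (lo u)
      rw [hl] at hlt
      nlinarith
    rw [index, table, hl, testBit_doubleTable (doubleTable_lt (table_lt f a cs) _) h2,
      testBit_doubleTable (table_lt f a cs) (hl ▸ hlt), ih hl, dot]
    have h0 : f 0 = false := by simpa using hf 0 0
    have hw : ∀ c : GF4, w2 * c = c + w * c := by decide
    have hz : ∀ c : GF4, zero * c = 0 := by decide
    have ho : ∀ c : GF4, one * c = c := by decide
    cases u <;> simp only [lo, hi, hw, hz, ho, hf, h0] <;>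
      cases f a <;> cases f c <;> cases f (w * c) <;> cases f (dot us cs) <;> rfl

/-- The indicator table of the messages `1 :: us` with `dot (1 :: us) col ≠ 0`. -/
def supportTable : List GF4 → ℕ
  | [] => 0
  | a :: cs => table lo a cs ||| table hi a cs

theorem testBit_supportTable {us col : List GF4} (h : col.length = us.length + 1) :
    (supportTable col).testBit (index us) = decide (dot (1 :: us) col ≠ 0) := by
  obtain ⟨a, cs, rfl⟩ := List.exists_cons_of_length_eq_add_one h
  have hl : us.length = cs.length := by simpa using h.symm
  rw [supportTable, Nat.testBit_or, testBit_table lo_add a hl, testBit_table hi_add a hl, dot,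
    one_mul]
  generalize a + dot us cs = z
  revert z
  decide

end GF4

/-- The value at position `i` of a bit-sliced counter: the entries of the list are truth tables of
the binary digits of the counters, least significant digit first. -/
def counterValue (i : ℕ) : List ℕ → ℕ
  | [] => 0
  | s :: ss => (s.testBit i).toNat + 2 * counterValue i ss

/-- Add the truth table `c` to a bit-sliced counter; the carry out of the last digit is lost. -/
def counterAdd : List ℕ → ℕ → List ℕ
  | [], _ => []
  | s :: ss, c => (s ^^^ c) :: counterAdd ss (s &&& c)

/-- The bit-sliced counter with `n` digits and the constant value `e` (modulo `2 ^ n`) at the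
positions covered by `mask`. -/
def counterConst (mask : ℕ) : ℕ → ℕ → List ℕ
  | 0, _ => []
  | n + 1, e => (bif e % 2 == 1 then mask else 0) :: counterConst mask n (e / 2)

/-- Because a lost carry only makes the counter smaller, no bound on the counter is needed. -/
theorem counterValue_counterAdd_le (i : ℕ) (ss : List ℕ) (c : ℕ) :
    counterValue i (counterAdd ss c) ≤ counterValue i ss + (c.testBit i).toNat := by
  induction ss generalizing c with
  | nil => simp [counterAdd, counterValue]
  | cons s ss ih =>
    have := ih (s &&& c)
    simp only [counterAdd, counterValue, Nat.testBit_xor]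
    rw [Nat.testBit_and] at this
    generalize s.testBit i = p at this ⊢
    generalize c.testBit i = r at this ⊢
    cases p <;> cases r <;> simp at this ⊢ <;> omega

theorem counterValue_counterConst_le (i mask n e : ℕ) :
    counterValue i (counterConst mask n e) ≤ e := by
  induction n generalizing e with
  | zero => simp [counterConst, counterValue]
  | succ n ih =>
    have h1 := ih (e / 2)
    have h2 := Bool.toNat_le (mask.testBit i)
    rcases Nat.mod_two_eq_zero_or_one e with h | h <;>
      simp [counterConst, counterValue, h] <;> omega

theorem le_counterValue_of_testBit {i j : ℕ} {ss : List ℕ} (h : (ss.getD j 0).testBit i = true) :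
    2 ^ j ≤ counterValue i ss := by
  induction j generalizing ss with
  | zero =>
    cases ss with
    | nil => simp at h
    | cons s ss =>
      have h : s.testBit i = true := by simpa using h
      simp [counterValue, h]
  | succ j ih =>
    cases ss with
    | nil => simp at h
    | cons s ss =>
      have := ih (ss := ss) (by simpa using h)
      rw [counterValue, pow_succ]
      omega

namespace GF4

/-- The weight of the codeword with message `us` in the code whose generator matrix has the
columns `cols`. -/
def weight (cols : List (List GF4)) (us : List GF4) : ℕ :=
  (cols.map fun col => if dot us col ≠ 0 then 1 else 0).sum

/-- The bit-sliced counter of the weights of all messages `1 :: us`, starting from `ss`. -/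
def countSupports (ss : List ℕ) : List (List GF4) → List ℕ
  | [] => ss
  | col :: cols => countSupports (counterAdd ss (supportTable col)) cols

theorem counterValue_countSupports_le {us : List GF4} (cols : List (List GF4))
    (h : ∀ col ∈ cols, col.length = us.length + 1) (ss : List ℕ) :
    counterValue (index us) (countSupports ss cols) ≤
      counterValue (index us) ss + weight cols (1 :: us) := by
  induction cols generalizing ss with
  | nil => simp [countSupports, weight]
  | cons col cols ih =>
    have h1 := ih (fun c hc => h c (List.mem_cons_of_mem _ hc))
      (counterAdd ss (supportTable col))
    have h2 := counterValue_counterAdd_le (index us) ss (supportTable col)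
    rw [testBit_supportTable (h col List.mem_cons_self)] at h2
    rw [countSupports]
    by_cases hz : dot (1 :: us) col = 0 <;> simp [weight, hz] at h1 h2 ⊢ <;> omega

/-- Whether all messages `1 :: us` with `us` of length `m` have weight at least `d`.
The six-digit counters start at `32 - d`, so that weight at least `d` shows as the digit `32`;
this needs `d ≤ 32`. -/
def leadingOneCheck (d m : ℕ) (cols : List (List GF4)) : Bool :=
  ((countSupports (counterConst (2 ^ 4 ^ m - 1) 6 (32 - d)) cols).getD 5 0).beq (2 ^ 4 ^ m - 1)

theorem le_weight_of_leadingOneCheck {d : ℕ} (hd : d ≤ 32) {us : List GF4}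
    {cols : List (List GF4)} (h : ∀ col ∈ cols, col.length = us.length + 1)
    (hc : leadingOneCheck d us.length cols = true) : d ≤ weight cols (1 :: us) := by
  rw [leadingOneCheck, Nat.beq_eq] at hc
  have h1 : ((countSupports (counterConst (2 ^ 4 ^ us.length - 1) 6 (32 - d)) cols).getD 5
      0).testBit (index us) = true := by
    rw [hc, Nat.testBit_two_pow_sub_one]
    simpa using index_lt us
  have h2 := le_counterValue_of_testBit h1
  have h3 := counterValue_countSupports_le cols h
    (counterConst (2 ^ 4 ^ us.length - 1) 6 (32 - d))
  have h4 := counterValue_counterConst_le (index us) (2 ^ 4 ^ us.length - 1) 6 (32 - d)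
  omega

/-- Whether all nonzero messages of length `k` have weight at least `d`: up to a scalar factor such
a message is a run of zeros followed by a message with leading entry `1`. -/
def minWeightCheck (d : ℕ) : ℕ → List (List GF4) → Bool
  | 0, _ => true
  | k + 1, cols => leadingOneCheck d k cols && minWeightCheck d k (cols.map List.tail)

theorem dot_map_mul_left (a : GF4) (us cs : List GF4) :
    dot (us.map (a * ·)) cs = a * dot us cs := by
  induction us generalizing cs with
  | nil => simp [dot]
  | cons u us ih =>
    cases cs with
    | nil => simp [dot]
    | cons c cs => simp [dot, ih, mul_add, mul_assoc]

theorem weight_map_mul_left {a : GF4} (ha : a ≠ 0) (cols : List (List GF4)) (us : List GF4) :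
    weight cols (us.map (a * ·)) = weight cols us := by
  simp [weight, dot_map_mul_left, ha]

theorem le_weight_of_minWeightCheck {d : ℕ} (hd : d ≤ 32) {us : List GF4}
    {cols : List (List GF4)} (h : ∀ col ∈ cols, col.length = us.length)
    (hc : minWeightCheck d us.length cols = true) (hne : ∃ u ∈ us, u ≠ 0) :
    d ≤ weight cols us := by
  induction us generalizing cols with
  | nil => simp at hne
  | cons u us ih =>
    rw [List.length_cons, minWeightCheck, Bool.and_eq_true] at hc
    by_cases hu : u = 0
    · have h1 := ih (cols := cols.map List.tail) (by simpa using fun c hc => by simp [h c hc])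
        hc.2 (by simpa [hu] using hne)
      refine h1.trans_eq ?_
      simp only [weight, List.map_map]
      congr 1
      refine List.map_congr_left fun col hcol => ?_
      obtain ⟨c, cs, rfl⟩ := List.exists_cons_of_length_eq_add_one (h col hcol)
      have hdot : dot (u :: us) (c :: cs) = dot us (c :: cs).tail := by simp [dot, hu]
      rw [Function.comp, hdot]
    · -- Scaling by `u⁻¹` turns the leading entry into `1` and keeps the weight.
      have h1 := le_weight_of_leadingOneCheck hd (us := us.map (u⁻¹ * ·)) (by simpa using h)
        (by simpa using hc.1)
      rw [← weight_map_mul_left (inv_ne_zero hu)]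
      simpa [hu] using h1

/-- The columns of a matrix, as lists. -/
def columns {k n : ℕ} (G : Matrix (Fin k) (Fin n) GF4) : List (List GF4) :=
  List.ofFn fun j => List.ofFn fun i => G i j

theorem dot_ofFn {k : ℕ} (u c : Fin k → GF4) :
    dot (List.ofFn u) (List.ofFn c) = ∑ i, u i * c i := by
  induction k with
  | zero => simp [dot]
  | succ k ih => simp [dot, List.ofFn_succ, Fin.sum_univ_succ, ih]

theorem weight_columns {k n : ℕ} (G : Matrix (Fin k) (Fin n) GF4) (u : Fin k → GF4) :
    weight (columns G) (List.ofFn u) = hammingNorm (Matrix.vecMul u G) := by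
  rw [weight, columns, List.map_ofFn, List.sum_ofFn]
  simp [dot_ofFn, hammingNorm, Matrix.vecMul, dotProduct,
    Finset.card_filter]

theorem le_hammingNorm_of_minWeightCheck {k n d : ℕ} (hd : d ≤ 32)
    {G : Matrix (Fin k) (Fin n) GF4} (hc : minWeightCheck d k (columns G) = true)
    {u : Fin k → GF4} (hu : u ≠ 0) : d ≤ hammingNorm (Matrix.vecMul u G) := by
  rw [← weight_columns]
  refine le_weight_of_minWeightCheck hd ?_ (by simpa using hc) ?_
  · simp [columns]
  · obtain ⟨i, hi⟩ := Function.ne_iff.1 hu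
    exact ⟨u i, by simp [List.mem_ofFn], hi⟩

end GF4

/-! ### The Gram matrix criterion and the transvections `r ↦ r + (r, y)_h x - (r, x)_h y` -/

/-- The Hermitian Gram matrix of the rows of `(I_k  A)`. -/
def systematicGram {F : Type*} [Field F] {k m : ℕ} (q : ℕ) (A : Matrix (Fin k) (Fin m) F) :
    Matrix (Fin k) (Fin k) F :=
  Matrix.of fun i i' => (1 : Matrix (Fin k) (Fin k) F) i i' + hermInner q (A i) (A i')

theorem hermInner_systematicMatrix {F : Type*} [Field F] {k m : ℕ} {q : ℕ} (hq : q ≠ 0)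
    (A : Matrix (Fin k) (Fin m) F) (i i' : Fin k) :
    hermInner q (systematicMatrix A i) (systematicMatrix A i') = systematicGram q A i i' := by
  simp [hermInner, systematicMatrix, systematicGram, Fin.sum_univ_add, Matrix.one_apply, ite_pow,
    hq]

/-- A codeword `u (I_k  A)` that is orthogonal to the rows of `(I_k  A)` satisfies `u N = 0` for
the Gram matrix `N`, so that an inverse of `N` shows the code to be LCD. -/
theorem isHermitianLCD_systematicCode {F : Type*} [Field F] {k m : ℕ} {q : ℕ} (hq : q ≠ 0)
    {A : Matrix (Fin k) (Fin m) F} {N : Matrix (Fin k) (Fin k) F}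
    (hN : systematicGram q A * N = 1) : IsHermitianLCD q (systematicCode A) := by
  rw [IsHermitianLCD, eq_bot_iff]
  rintro c ⟨hc, hdual⟩
  obtain ⟨u, rfl⟩ := mem_systematicCode.1 hc
  have hu : Matrix.vecMul u (systematicGram q A) = 0 := by
    ext i'
    have h := hdual (systematicMatrix A i') (Submodule.subset_span ⟨i', rfl⟩)
    simp only [hermInner, Matrix.vecMul, dotProduct, Finset.sum_mul] at h
    rw [Finset.sum_comm] at h
    simp only [Matrix.vecMul, dotProduct, ← hermInner_systematicMatrix hq, hermInner,
      Finset.mul_sum]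
    simpa only [mul_assoc, Pi.zero_apply] using h
  have hz : u = 0 := by
    rw [← Matrix.vecMul_one u, ← hN, ← Matrix.vecMul_vecMul, hu, Matrix.zero_vecMul]
  rw [Submodule.mem_bot, hz, Matrix.zero_vecMul]

namespace GF4

variable {n : ℕ}

theorem hermInner_add_left (x y z : Fin n → GF4) :
    hermInner 2 (x + y) z = hermInner 2 x z + hermInner 2 y z := by
  simp [hermInner, add_mul, Finset.sum_add_distrib]

theorem hermInner_smul_left (a : GF4) (x z : Fin n → GF4) :
    hermInner 2 (a • x) z = a * hermInner 2 x z := by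
  simp [hermInner, mul_assoc, Finset.mul_sum]

/-- Conjugate symmetry, from additivity of `a ↦ a ^ 2` and `a ^ 4 = a`. -/
theorem hermInner_conj (x y : Fin n → GF4) : hermInner 2 x y ^ 2 = hermInner 2 y x := by
  let frob : GF4 →+* GF4 :=
    { toFun := fun a => a ^ 2, map_one' := one_pow 2, map_mul' := fun a b => mul_pow a b 2,
      map_zero' := rfl, map_add' := sq_add }
  change frob (hermInner 2 x y) = _
  rw [hermInner, map_sum]
  refine Finset.sum_congr rfl fun i _ => ?_
  change (x i * y i ^ 2) ^ 2 = _
  rw [mul_pow, sq_sq, mul_comm]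

theorem hermInner_add_right (x y z : Fin n → GF4) :
    hermInner 2 x (y + z) = hermInner 2 x y + hermInner 2 x z := by
  simp [hermInner, sq_add, mul_add, Finset.sum_add_distrib]

theorem hermInner_smul_right (a : GF4) (x z : Fin n → GF4) :
    hermInner 2 x (a • z) = a ^ 2 * hermInner 2 x z := by
  simp [hermInner, mul_pow, mul_left_comm, Finset.mul_sum]

/-- For isotropic, orthogonal `x` and `y` the map that takes the rows of `A` to those of `A(x, y)`
is unitary, so that the Gram matrix does not change. -/
theorem systematicGram_modifiedMatrix {k m : ℕ} (A : Matrix (Fin k) (Fin m) GF4)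
    {x y : Fin m → GF4} (hx : hermInner 2 x x = 0) (hy : hermInner 2 y y = 0)
    (hxy : hermInner 2 x y = 0) :
    systematicGram 2 (modifiedMatrix 2 A x y) = systematicGram 2 A := by
  have hyx : hermInner 2 y x = 0 := by rw [← hermInner_conj, hxy, zero_pow two_ne_zero]
  have hrow (i : Fin k) : modifiedMatrix 2 A x y i =
      A i + hermInner 2 (A i) y • x + hermInner 2 (A i) x • y := by
    ext j
    simp [modifiedMatrix, sub_eq_add]
  ext i i'
  have h : hermInner 2 (modifiedMatrix 2 A x y i) (modifiedMatrix 2 A x y i') =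
      hermInner 2 (A i) (A i') := by
    rw [hrow, hrow]
    simp only [hermInner_add_left, hermInner_add_right, hermInner_smul_left,
      hermInner_smul_right, hx, hy, hxy, hyx, hermInner_conj (A i') x,
      hermInner_conj (A i') y]
    linear_combination add_self (hermInner 2 (A i) x * hermInner 2 y (A i')) +
      add_self (hermInner 2 (A i) y * hermInner 2 x (A i'))
  rw [systematicGram, systematicGram, Matrix.of_apply, Matrix.of_apply, h]

/-! ### Certificates for the construction -/

/-- The check gives the lower bound for the minimum weight; the message `u` shows that it is
attained. -/
theorem isHermitianLCDCode_of_minWeightCheck {k m d : ℕ} (hd : d ≤ 32)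
    {A : Matrix (Fin k) (Fin m) GF4} {N : Matrix (Fin k) (Fin k) GF4}
    (hN : systematicGram 2 A * N = 1)
    (hc : minWeightCheck d k (columns (systematicMatrix A)) = true)
    {u : Fin k → GF4} (hu : u ≠ 0)
    (hw : hammingNorm (Matrix.vecMul u (systematicMatrix A)) = d) :
    IsHermitianLCDCode 2 k d (systematicCode A) := by
  refine ⟨finrank_systematicCode A, ⟨?_, ?_⟩, isHermitianLCD_systematicCode two_ne_zero hN⟩
  · exact ⟨_, mem_systematicCode.2 ⟨u, rfl⟩, (vecMul_systematicMatrix_eq_zero_iff A u).not.2 hu,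
      hw⟩
  · rintro w ⟨c, hcA, h0, rfl⟩
    obtain ⟨v, rfl⟩ := mem_systematicCode.1 hcA
    exact le_hammingNorm_of_minWeightCheck hd hc
      ((vecMul_systematicMatrix_eq_zero_iff A v).not.1 h0)

/-- A vector given by its decimal digits, most significant digit first; the digits
`0, 1, 2, 3` stand for `0, 1, w, w2`. -/
def ofDigits (n r : ℕ) (j : Fin n) : GF4 :=
  match r / 10 ^ (n - 1 - j) % 10 with
  | 0 => zero | 1 => one | 2 => w | _ => w2

/-- A matrix whose rows are given by their decimal digits. -/
def matrixOfDigits {k : ℕ} (n : ℕ) (r : Fin k → ℕ) : Matrix (Fin k) (Fin n) GF4 :=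
  Matrix.of fun i => ofDigits n (r i)

/-- The data that certify an instance of the construction: the matrix `A`, the matrix `B = A(x, y)`
in evaluated form, an inverse `N` of the Gram matrix that `A` and `B` share, and messages `u` and
`v` of codewords of minimum weight. -/
theorem constructionYields_of_check {k m d₀ d : ℕ} {x y : Fin m → GF4}
    (A B : Matrix (Fin k) (Fin m) GF4) (N : Matrix (Fin k) (Fin k) GF4) (u v : Fin k → GF4)
    (hx : hermInner 2 x x = 0) (hy : hermInner 2 y y = 0) (hxy : hermInner 2 x y = 0)
    (hB : modifiedMatrix 2 A x y = B) (hN : systematicGram 2 A * N = 1)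
    (hd₀ : d₀ ≤ 32) (hd : d ≤ 32)
    (hA : minWeightCheck d₀ k (columns (systematicMatrix A)) = true)
    (hB' : minWeightCheck d k (columns (systematicMatrix B)) = true)
    (hu : u ≠ 0) (hv : v ≠ 0)
    (hwu : hammingNorm (Matrix.vecMul u (systematicMatrix A)) = d₀)
    (hwv : hammingNorm (Matrix.vecMul v (systematicMatrix B)) = d) :
    ConstructionYields 2 k m d₀ d x y := by
  subst hB
  exact ⟨hx, hy, hxy, A, isHermitianLCDCode_of_minWeightCheck hd₀ hN hA hu hwu,
    isHermitianLCDCode_of_minWeightCheck hd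
      ((congrArg (· * N) (systematicGram_modifiedMatrix A hx hy hxy)).trans hN) hB' hv hwv⟩

/-! ### The eight pairs of codes -/

theorem constructionYields_27_6_15 :
    ConstructionYields 2 6 21 14 15
      ![w, one, w2, one, one, w, w, one, w, zero, zero, zero, w2, zero, w, zero, w, w, w, w2, w]
      ![w, w, w, w, w, w2, zero, w2, one, w2, zero, zero, zero, zero, w, one, w2, w, w2, w, w] := by
  refine constructionYields_of_check
    (matrixOfDigits 21 ![
      001322111131222203121, 212132113101320223000, 030021022323201330332, 000031220120011121111,
      230012331332300120331, 021211233101102013023])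
    (matrixOfDigits 21 ![
      133013020131023212000, 332311313001021012301, 133021330023300231303, 213123032120313103323,
      230012331332300120331, 130303210301103332232])
    (matrixOfDigits 6 ![
      002120, 003333, 320002, 120113, 320111, 023210])
    (ofDigits 6 103222) (ofDigits 6 100000)
    ?_ ?_ ?_ ?_ ?_ ?_ ?_ ?_ ?_ ?_ ?_ ?_ ?_ <;> decide +kernel

theorem constructionYields_27_8_13 :
    ConstructionYields 2 8 19 12 13
      ![w2, zero, w, one, one, w2, zero, w2, w2, zero, w, one, zero, w2, w2, w, w2, one, zero]
      ![w2, w2, one, w2, w2, w, w2, one, one, w, one, zero, zero, one, w, zero, zero, w2, zero] := by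
  refine constructionYields_of_check
    (matrixOfDigits 19 ![
      3011012020312323213, 2321013223012131000, 2232200132333033022, 3200330100213130321,
      2000013221223112311, 1231330212032201102, 1332000110002311122, 2331030211000303210])
    (matrixOfDigits 19 ![
      3230120131122212003, 1300123113202203310, 2321121201213310112, 1121203102033103231,
      0232201110123202331, 1010202303202330312, 0213131333202121132, 1022313303100223220])
    (matrixOfDigits 8 ![
      03123330, 20101100, 11020131, 30303313, 21020330, 21122032, 20212200, 00120300])
    (ofDigits 8 10003003) (ofDigits 8 10000211)
    ?_ ?_ ?_ ?_ ?_ ?_ ?_ ?_ ?_ ?_ ?_ ?_ ?_ <;> decide +kernel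

theorem constructionYields_27_9_12 :
    ConstructionYields 2 9 18 11 12
      ![one, one, one, w, zero, one, zero, w, zero, w, zero, w2, w, one, w, one, w2, w]
      ![zero, zero, w2, one, w, w, w, zero, one, zero, w, one, one, w2, one, w2, zero, zero] := by
  refine constructionYields_of_check
    (matrixOfDigits 18 ![
      123002103330002323, 123003223103101132, 022302121322313200, 001023222213200313,
      332023200123111130, 121332310020331332, 100301230201201112, 122302323110032300,
      101122223302032202])
    (matrixOfDigits 18 ![
      030112020120133011, 120121022122030232, 131212002132222132, 113300003031123121,
      000313112013232311, 212231300122200013, 013211313011330220, 032330001321032332,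
      232021233200103123])
    (matrixOfDigits 9 ![
      132231330, 212321023, 331311003, 322100303, 231012030, 111031223, 200203101, 230023013,
      022202121])
    (ofDigits 9 100000010) (ofDigits 9 100000230)
    ?_ ?_ ?_ ?_ ?_ ?_ ?_ ?_ ?_ ?_ ?_ ?_ ?_ <;> decide +kernel

theorem constructionYields_27_11_10 :
    ConstructionYields 2 11 16 9 10
      ![w2, one, one, w2, w, zero, w2, w, w2, zero, w, w2, one, one, w, w2]
      ![zero, zero, zero, one, one, w2, one, w, one, zero, one, w2, one, zero, one, zero] := by
  refine constructionYields_of_check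
    (matrixOfDigits 16 ![
      3300132221233032, 3130030311121232, 1001003321210210, 0321023221013002, 2201230212231012,
      1223313000021203, 2131002031020030, 1022202221331202, 3011330332122120, 1201001331211021,
      0110221110221303])
    (matrixOfDigits 16 ![
      2123021211333223, 2310200211302013, 3331313121121122, 2011333021322330, 1312033022000131,
      3110320330033101, 2131002031020030, 0203103131023033, 3010201122013130, 0022112301311230,
      1332203330210102])
    (matrixOfDigits 11 ![
      11220100011, 11213000212, 33132100123, 31210203033, 02301131010, 10131122103, 00002301022,
      00021310133, 03100101120, 11321032312, 13220232030])
    (ofDigits 11 10000210001) (ofDigits 11 10000000002)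
    ?_ ?_ ?_ ?_ ?_ ?_ ?_ ?_ ?_ ?_ ?_ ?_ ?_ <;> decide +kernel

theorem constructionYields_28_11_11 :
    ConstructionYields 2 11 17 10 11
      ![w, w2, zero, w, w, zero, w, one, w2, zero, zero, zero, one, one, w2, w, one]
      ![zero, w2, w2, one, zero, zero, one, w, w2, one, w, one, w, zero, zero, w2, w] := by
  refine constructionYields_of_check
    (matrixOfDigits 17 ![
      22313200013333201, 02100310101320330, 31002233320003021, 10013001301310312,
      22320230112230131, 33331010032012201, 32103203021302120, 12332101213320013,
      30320232120122231, 30333312231100112, 02213132133200002])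
    (matrixOfDigits 17 ![
      10030220201231301, 31303313230012223, 30122210203233032, 00232023330033120,
      33021231000323310, 33331010032012201, 00220223233200020, 10102130022030032,
      21021233032031010, 20112330200223320, 11322102210003202])
    (matrixOfDigits 11 ![
      03221022332, 20320101013, 32003121222, 33013302203, 10221221212, 01123120021, 30303313211,
      31131021233, 20333033010, 21301312103, 32323112020])
    (ofDigits 11 10000020012) (ofDigits 11 10000000210)
    ?_ ?_ ?_ ?_ ?_ ?_ ?_ ?_ ?_ ?_ ?_ ?_ ?_ <;> decide +kernel

theorem constructionYields_29_11_11 :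
    ConstructionYields 2 11 18 10 11
      ![zero, w, zero, one, zero, w, w, w2, one, w, w2, one, zero, w2, zero, w2, w2, zero]
      ![w2, w2, w, w, w2, w, zero, one, w2, zero, w2, zero, zero, one, one, w, zero, zero] := by
  refine constructionYields_of_check
    (matrixOfDigits 18 ![
      101312310303121333, 133032111110233301, 123020113312200330, 102212302120332000,
      022002011322003203, 111130021322013202, 011133223122103100, 233002303313221223,
      302302130231123323, 223123232213120220, 011032133122132112])
    (matrixOfDigits 18 ![
      101312310303121333, 010122222212201111, 211212100322211130, 011101323130310300,
      223021212133000033, 022321231103001232, 303203001323122030, 320311322303203123,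
      332101222123133233, 022100031002123010, 021231221230122002])
    (matrixOfDigits 11 ![
      03313113230, 20231211301, 23110203131, 12111102222, 21011212201, 13313113213, 11001102200,
      21233230033, 32133330132, 20230102210, 01131202301])
    (ofDigits 11 12100300000) (ofDigits 11 10000000032)
    ?_ ?_ ?_ ?_ ?_ ?_ ?_ ?_ ?_ ?_ ?_ ?_ ?_ <;> decide +kernel

theorem constructionYields_30_7_16 :
    ConstructionYields 2 7 23 15 16
      ![w2, w, one, one, zero, w2, w2, w, one, one, w2, zero, zero, w2, one, w2, w2, w2, zero, w,
        w, zero, w2]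
      ![one, w, one, zero, zero, one, w, one, one, w, one, zero, one, zero, w, zero, w2, w2, one,
        w2, w, zero, zero] := by
  refine constructionYields_of_check
    (matrixOfDigits 23 ![
      33121210113001130323330, 02101330223102200011101, 01010221102111313010032,
      23002113013331303130112, 31012213320130123313112, 03210123322022130220203,
      00201213303101000231013])
    (matrixOfDigits 23 ![
      23111322132033310310332, 21301102011122101130201, 10300321223132121233131,
      10232213200323222022210, 02222113133122002201210, 10030030103023321323102,
      13021300122100211332312])
    (matrixOfDigits 7 ![
      0131000, 1103113, 2012020, 1230030, 0100020, 0132300, 0200000])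
    (ofDigits 7 1001023) (ofDigits 7 1000001)
    ?_ ?_ ?_ ?_ ?_ ?_ ?_ ?_ ?_ ?_ ?_ ?_ ?_ <;> decide +kernel

theorem constructionYields_30_12_11 :
    ConstructionYields 2 12 18 10 11
      ![one, zero, zero, one, w, zero, w, zero, w2, w2, w2, w2, one, w, zero, zero, w, one]
      ![one, w2, zero, zero, w2, w, zero, w2, zero, w2, w2, zero, w, zero, one, w2, w2, w2] := by
  refine constructionYields_of_check
    (matrixOfDigits 18 ![
      200130330331230123, 021031220211330002, 320302121002230122, 212011013010123013,
      212313211333020113, 030220113101032332, 012302333322311323, 002331002033303212,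
      133322322331010131, 301113221032302001, 311202320301122310, 131102023130320020])
    (matrixOfDigits 18 ![
      220201212333023312, 101220101120003212, 310210312001111230, 202232302011011130,
      022031323221131233, 010111031103221103, 332323313102212101, 002331002033303212,
      133322322331010131, 211210333300310103, 031223300121021132, 001130013200121313])
    (matrixOfDigits 12 ![
      131101113311, 212122310130, 131132323133, 111030202123, 032210311331, 133000330303,
      122322102031, 113012010313, 202310300200, 211122023133, 122320210213, 102212120220])
    (ofDigits 12 100300000010) (ofDigits 12 100000100020)
    ?_ ?_ ?_ ?_ ?_ ?_ ?_ ?_ ?_ ?_ ?_ ?_ ?_ <;> decide +kernel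

end GF4

end HermitianLCD

theorem proposition5p3 {F : Type*} [Field F] [Fintype F] [DecidableEq F]
    (hF : Fintype.card F = 4) (ω : F) (hω : ω ^ 2 + ω + 1 = 0) :
    (∀ n k d : ℕ,
      (n, k, d) ∈ ({(27, 6, 15), (27, 8, 13), (27, 9, 12), (27, 11, 10),
        (28, 11, 11), (29, 11, 11), (30, 7, 16), (30, 12, 11)} : Set (ℕ × ℕ × ℕ)) →
      ∃ C : Submodule F (Fin n → F), HermitianLCD.IsHermitianLCDCode 2 k d C) ∧
    HermitianLCD.ConstructionYields 2 6 21 14 15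
      ![ω, 1, ω ^ 2, 1, 1, ω, ω, 1, ω, 0, 0, 0, ω ^ 2, 0, ω, 0, ω, ω, ω, ω ^ 2, ω]
      ![ω, ω, ω, ω, ω, ω ^ 2, 0, ω ^ 2, 1, ω ^ 2, 0, 0, 0, 0, ω, 1, ω ^ 2, ω, ω ^ 2, ω, ω] ∧
    HermitianLCD.ConstructionYields 2 8 19 12 13
      ![ω ^ 2, 0, ω, 1, 1, ω ^ 2, 0, ω ^ 2, ω ^ 2, 0, ω, 1, 0, ω ^ 2, ω ^ 2, ω, ω ^ 2, 1, 0]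
      ![ω ^ 2, ω ^ 2, 1, ω ^ 2, ω ^ 2, ω, ω ^ 2, 1, 1, ω, 1, 0, 0, 1, ω, 0, 0, ω ^ 2, 0] ∧
    HermitianLCD.ConstructionYields 2 9 18 11 12
      ![1, 1, 1, ω, 0, 1, 0, ω, 0, ω, 0, ω ^ 2, ω, 1, ω, 1, ω ^ 2, ω]
      ![0, 0, ω ^ 2, 1, ω, ω, ω, 0, 1, 0, ω, 1, 1, ω ^ 2, 1, ω ^ 2, 0, 0] ∧
    HermitianLCD.ConstructionYields 2 11 16 9 10
      ![ω ^ 2, 1, 1, ω ^ 2, ω, 0, ω ^ 2, ω, ω ^ 2, 0, ω, ω ^ 2, 1, 1, ω, ω ^ 2]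
      ![0, 0, 0, 1, 1, ω ^ 2, 1, ω, 1, 0, 1, ω ^ 2, 1, 0, 1, 0] ∧
    HermitianLCD.ConstructionYields 2 11 17 10 11
      ![ω, ω ^ 2, 0, ω, ω, 0, ω, 1, ω ^ 2, 0, 0, 0, 1, 1, ω ^ 2, ω, 1]
      ![0, ω ^ 2, ω ^ 2, 1, 0, 0, 1, ω, ω ^ 2, 1, ω, 1, ω, 0, 0, ω ^ 2, ω] ∧
    HermitianLCD.ConstructionYields 2 11 18 10 11
      ![0, ω, 0, 1, 0, ω, ω, ω ^ 2, 1, ω, ω ^ 2, 1, 0, ω ^ 2, 0, ω ^ 2, ω ^ 2, 0]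
      ![ω ^ 2, ω ^ 2, ω, ω, ω ^ 2, ω, 0, 1, ω ^ 2, 0, ω ^ 2, 0, 0, 1, 1, ω, 0, 0] ∧
    HermitianLCD.ConstructionYields 2 7 23 15 16
      ![ω ^ 2, ω, 1, 1, 0, ω ^ 2, ω ^ 2, ω, 1, 1, ω ^ 2, 0, 0, ω ^ 2, 1, ω ^ 2, ω ^ 2, ω ^ 2, 0, ω, ω, 0, ω ^ 2]
      ![1, ω, 1, 0, 0, 1, ω, 1, 1, ω, 1, 0, 1, 0, ω, 0, ω ^ 2, ω ^ 2, 1, ω ^ 2, ω, 0, 0] ∧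
    HermitianLCD.ConstructionYields 2 12 18 10 11
      ![1, 0, 0, 1, ω, 0, ω, 0, ω ^ 2, ω ^ 2, ω ^ 2, ω ^ 2, 1, ω, 0, 0, ω, 1]
      ![1, ω ^ 2, 0, 0, ω ^ 2, ω, 0, ω ^ 2, 0, ω ^ 2, ω ^ 2, 0, ω, 0, 1, ω ^ 2, ω ^ 2, ω ^ 2] := by
  obtain ⟨φ, h0, h1, hw, hw2⟩ := HermitianLCD.GF4.exists_ringEquiv hF ω hω
  have h_27_6 := HermitianLCD.GF4.constructionYields_27_6_15.map φ
  have h_27_8 := HermitianLCD.GF4.constructionYields_27_8_13.map φ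
  have h_27_9 := HermitianLCD.GF4.constructionYields_27_9_12.map φ
  have h_27_11 := HermitianLCD.GF4.constructionYields_27_11_10.map φ
  have h_28_11 := HermitianLCD.GF4.constructionYields_28_11_11.map φ
  have h_29_11 := HermitianLCD.GF4.constructionYields_29_11_11.map φ
  have h_30_7 := HermitianLCD.GF4.constructionYields_30_7_16.map φ
  have h_30_12 := HermitianLCD.GF4.constructionYields_30_12_11.map φ
  simp only [HermitianLCD.comp_vecCons, HermitianLCD.comp_vecEmpty, h0, h1, hw, hw2]
    at h_27_6 h_27_8 h_27_9 h_27_11 h_28_11 h_29_11 h_30_7 h_30_12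
  refine ⟨?_, h_27_6, h_27_8, h_27_9, h_27_11,
    h_28_11, h_29_11, h_30_7, h_30_12⟩
  intro n k d h
  simp only [Set.mem_insert_iff, Set.mem_singleton_iff, Prod.mk.injEq] at h
  rcases h with ⟨rfl, rfl, rfl⟩ | ⟨rfl, rfl, rfl⟩ | ⟨rfl, rfl, rfl⟩ | ⟨rfl, rfl, rfl⟩ |
    ⟨rfl, rfl, rfl⟩ | ⟨rfl, rfl, rfl⟩ | ⟨rfl, rfl, rfl⟩ | ⟨rfl, rfl, rfl⟩
  · obtain ⟨-, -, -, A, -, hA⟩ := h_27_6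
    exact ⟨_, hA⟩
  · obtain ⟨-, -, -, A, -, hA⟩ := h_27_8
    exact ⟨_, hA⟩
  · obtain ⟨-, -, -, A, -, hA⟩ := h_27_9
    exact ⟨_, hA⟩
  · obtain ⟨-, -, -, A, -, hA⟩ := h_27_11
    exact ⟨_, hA⟩
  · obtain ⟨-, -, -, A, -, hA⟩ := h_28_11
    exact ⟨_, hA⟩
  · obtain ⟨-, -, -, A, -, hA⟩ := h_29_11
    exact ⟨_, hA⟩
  · obtain ⟨-, -, -, A, -, hA⟩ := h_30_7
    exact ⟨_, hA⟩
  · obtain ⟨-, -, -, A, -, hA⟩ := h_30_12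
    exact ⟨_, hA⟩
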